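/- Let $(X,Y)\sim p$ with values in $\mathbb{R}^d\times\{-1,+1\}$, where the label marginals $p(Y=1)\neq p(Y=-1)$ are known. Write $f_\theta(x)=\sum_{j=1}^d\theta_jx_j$, and let $L$ be one of the losses $L(y,\alpha)=e^{-y\alpha}$, $L(y,\alpha)=\log(1+e^{-y\alpha})$, $L(y,\alpha)=\max(1-y\alpha,0)$. Let $R(\theta)=\mathbb{E}_p\,L(Y,f_\theta(X))$ be the risk. Let $\Theta\subset\mathbb{R}^d$ be nonempty and compact, and let $E$ be a compact set of mixture parameters $\eta=(\mu_1,\mu_{-1},\sigma_1,\sigma_{-1})\in\mathbb{R}^2\times(0,\infty)^2$. Assume that for every $\theta\in\Theta$ there is $\eta\in E$ such that $f_\theta(X)\mid\{Y=y\}\sim N(\mu_y,\sigma_y^2)$ for $y=\pm1$ (in particular both marginals are positive). Let $X^{(1)},X^{(2)},\dots$ be iid with the distribution of $X$. For $\theta\in\Theta$ and $n\in\mathbb{N}$ let $\hat\eta^{(n)}(\theta)=(\hat\mu^{(n)},\hat\sigma^{(n)})\in E$ be any maximizer over $E$ of $$\ell_n(\mu,\sigma)=\sum_{i=1}^n\log\sum_{y=\pm1}p(Y=y)\,N\big(f_\theta(X^{(i)});\mu_y,\sigma_y^2\big),$$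 where $N(\cdot\,;\mu,\sigma^2)$ is the normal density, and put $$\hat R_n(\theta)=\sum_{y=\pm1}p(Y=y)\int_{\mathbb{R}}N\big(\alpha;\hat\mu^{(n)}_y,(\hat\sigma^{(n)}_y)^2\big)\,L(y,\alpha)\,d\alpha .$$ Then $R$ attains its minimum over $\Theta$, and, almost surely, the minimizers of $\hat R_n$ over $\Theta$ converge to those of $R$: with probability one, for every $\varepsilon>0$ there is $\delta>0$ such that for all sufficiently large $n$, every $t\in\Theta$ with $\hat R_n(t)\le\hat R_n(s)+\delta$ for all $s\in\Theta$ (in particular every minimizer of $\hat R_n$ over $\Theta$) lies within distance less than $\varepsilon$ of some minimizer of $R$ over $\Theta$. In particular, if $R$ has a unique minimizer $t^*$ over $\Theta$, then, with probability one, every sequence $(t_n)$ such that $t_n$ minimizes $\hat R_n$ over $\Theta$ for all sufficiently large $n$ converges to $t^*$, i.e. $$P\Big(\lim_{n\to\infty}\operatorname*{argmin}_{\theta\in\Theta}\hat R_n(\theta)=\operatorname*{argmin}_{\theta\in\Theta}R(\theta)\Big)=1 .$$ -/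

import Mathlib

open MeasureTheory ProbabilityTheory Filter Topology

noncomputable section

/-- A label `y ∈ {-1, +1}` (a unit of `ℤ`), seen as a real number. -/
def labelVal (y : ℤˣ) : ℝ := ((y : ℤ) : ℝ)

/-- The linear score `f_θ(x) = ∑ j, θ_j x_j`. -/
def score {d : ℕ} (θ x : EuclideanSpace ℝ (Fin d)) : ℝ := ∑ j, θ j * x j

/-- Exponential loss `L₁(y, α) = exp(-yα)`. -/
def expLoss (y : ℤˣ) (α : ℝ) : ℝ := Real.exp (-(labelVal y * α))

/-- Log loss `L₂(y, α) = log(1 + exp(-yα))`. -/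
def logLoss (y : ℤˣ) (α : ℝ) : ℝ := Real.log (1 + Real.exp (-(labelVal y * α)))

/-- Hinge loss `L₃(y, α) = (1 - yα)₊`. -/
def hingeLoss (y : ℤˣ) (α : ℝ) : ℝ := max (1 - labelVal y * α) 0

/-- The label marginal `p(Y = y)` of a joint distribution `p` of `(X, Y)`. -/
def labelMarginal {d : ℕ} (p : Measure (EuclideanSpace ℝ (Fin d) × ℤˣ)) (y : ℤˣ) : ℝ :=
  p.real {z | z.2 = y}

/-- The conditional law of `f_θ(X)` given `Y = y`, for `(X, Y) ∼ p`. -/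
def scoreLaw {d : ℕ} (p : Measure (EuclideanSpace ℝ (Fin d) × ℤˣ))
    (θ : EuclideanSpace ℝ (Fin d)) (y : ℤˣ) : Measure ℝ :=
  (cond p {z | z.2 = y}).map (fun z => score θ z.1)

/-- The true margin-based risk `R(θ) = E_p L(Y, f_θ(X))`. -/
def risk {d : ℕ} (p : Measure (EuclideanSpace ℝ (Fin d) × ℤˣ)) (L : ℤˣ → ℝ → ℝ)
    (θ : EuclideanSpace ℝ (Fin d)) : ℝ :=
  ∫ z, L z.2 (score θ z.1) ∂p

/-- The parameters `η = (μ_y, σ_y)_{y = ±1}` of a two-component Gaussian mixture: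
`(η y).1 = μ_y` is the mean and `(η y).2 = σ_y` the standard deviation of component `y`. -/
abbrev MixParams : Type := ℤˣ → ℝ × ℝ

/-- The density of `N(μ_y, σ_y²)` at `a`. -/
def componentPDF (η : MixParams) (y : ℤˣ) (a : ℝ) : ℝ :=
  gaussianPDFReal (η y).1 (Real.toNNReal ((η y).2 ^ 2)) a

/-- The mixture log-likelihood
`ℓ_n(η) = ∑_{i < n} log ∑_y π_y N(z_i; μ_y, σ_y²)` of the sample `z_0, …, z_{n-1}`,
with known weights `π`. -/
def logLik (π : ℤˣ → ℝ) (z : ℕ → ℝ) (n : ℕ) (η : MixParams) : ℝ :=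
  ∑ i ∈ Finset.range n, Real.log (∑ y : ℤˣ, π y * componentPDF η y (z i))

/-- `η` is a maximizer of `ℓ_n` over the parameter set `E`. -/
def IsMLE (E : Set MixParams) (π : ℤˣ → ℝ) (z : ℕ → ℝ) (n : ℕ) (η : MixParams) : Prop :=
  η ∈ E ∧ IsMaxOn (logLik π z n) E η

/-- The plug-in risk `∑_y π_y ∫ N(α; μ_y, σ_y²) L(y, α) dα` at the parameter value `η`. -/
def plugInRisk (π : ℤˣ → ℝ) (L : ℤˣ → ℝ → ℝ) (η : MixParams) : ℝ :=
  ∑ y : ℤˣ, π y * ∫ α : ℝ, componentPDF η y α * L y α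

/-- The set of minimizers of `F` over `S`. -/
def argminOn {α : Type*} (F : α → ℝ) (S : Set α) : Set α := {t | t ∈ S ∧ IsMinOn F S t}

end

/-!
The data enter the estimates only through the log-likelihood of the scores, so the argument has a
deterministic core and two probabilistic inputs.

*Core.* Let `A`, `B` be compact, and let continuous criteria on `A × B` converge uniformly to `M`,
where every `M (a, ·)` has a unique maximizer `h a`. Then `h` is continuous
(`continuous_of_unique_max`), and off any neighbourhood of its graph `M` stays below its fibrewise
maximum by a fixed amount. Hence maximizers of the approximating criteria converge to `h`, uniformly
in `a`, also after a continuous map `ψ` (`eventually_forall_abs_sub_lt_of_tendsto`), and approximate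
minimizers of the plug-in criteria approach minimizers of `ψ ∘ h`
(`exists_eventually_dist_minimizer_lt`). Here `A = Θ`, `B = E`, `M` is the expected log-likelihood,
`h θ` the true mixture parameter and `ψ` the plug-in risk. The last is continuous since, written over
a standard normal variable, its integrand is dominated by exponentials (`continuous_plugInRisk`),
and `ψ (h θ)` is the true risk (`risk_eq_plugInRisk`).

*Uniqueness.* Gibbs' inequality (`integral_mul_log_lt_of_ne`) shows that only parameters with the
true mixture density maximize the expected log-likelihood. Densities of distinct normal laws are
linearly independent (`linearIndependent_gaussianPDFReal`), so a mixture with known unequal weights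
determines its parameters (`mixturePDF_injOn`); with equal weights the two components could be
exchanged.

*Uniform convergence.* The log-likelihood of one observation is a random element of the separable
Banach space `C(Θ × E, ℝ)`, so the uniform law of large numbers is the strong law in that space
(`exists_ae_tendsto_average_continuousMap`). Its norm is integrable: the log-density grows at most
quadratically in the score, uniformly over `E` (`exists_abs_log_mixturePDF_le`), and the squared
scores have an integrable envelope over `Θ` (`exists_integrable_sq_score_le`), although `X` itself
need not have any moments.
-/

/-! ### Consistency of approximate minimizers of a plug-in criterion -/

/-- If every `M (a, ·)` has a unique maximizer `h a` in a compact space, then `h` is continuous: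
its graph is cut out by closed conditions. -/
theorem continuous_of_unique_max {A B : Type*} [TopologicalSpace A] [TopologicalSpace B]
    [CompactSpace B] {M : A × B → ℝ} (hM : Continuous M) {h : A → B}
    (hmax : ∀ a b, b ≠ h a → M (a, b) < M (a, h a)) : Continuous h := by
  have hgraph : {q : A × B | q.2 = h q.1} = ⋂ b : B, {q : A × B | M (q.1, b) ≤ M q} := by
    ext ⟨a, b⟩
    simp only [Set.mem_ofPred_eq, Set.mem_iInter]
    constructor
    · rintro rfl b'
      rcases eq_or_ne b' (h a) with rfl | hb
      · exact le_rfl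
      · exact (hmax a b' hb).le
    · intro H
      by_contra hb
      exact absurd (H (h a)) (not_le.2 (hmax a b hb))
  have hclosed : IsClosed {q : A × B | q.2 = h q.1} := by
    rw [hgraph]
    exact isClosed_iInter fun b => isClosed_le (by fun_prop) hM
  refine continuous_iff_isClosed.2 fun C hC => ?_
  have hpre : h ⁻¹' C = Prod.fst '' ({q : A × B | q.2 = h q.1} ∩ Prod.snd ⁻¹' C) := by
    ext a
    constructor
    · intro ha
      exact ⟨(a, h a), ⟨rfl, ha⟩, rfl⟩
    · rintro ⟨⟨a', b⟩, ⟨hb, hbC⟩, rfl⟩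
      simp only [Set.mem_ofPred_eq, Set.mem_preimage] at hb hbC ⊢
      exact hb ▸ hbC
  rw [hpre]
  exact isClosedMap_fst_of_compactSpace _ (hclosed.inter (hC.preimage continuous_snd))

/-- Let the criteria `Mn n` converge uniformly to `M`, where `M (a, ·)` has the unique maximizer
`h a`, and let `b n a` maximize `Mn n (a, ·)`. Then `ψ (b n ·)` converges uniformly to `ψ ∘ h`. -/
theorem eventually_forall_abs_sub_lt_of_tendsto {A B : Type*} [TopologicalSpace A] [CompactSpace A]
    [TopologicalSpace B] [CompactSpace B] {M : C(A × B, ℝ)} {h : A → B}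
    (hmax : ∀ a b, b ≠ h a → M (a, b) < M (a, h a)) {Mn : ℕ → C(A × B, ℝ)}
    (hMn : Tendsto Mn atTop (𝓝 M)) {b : ℕ → A → B}
    (hb : ∀ n a b', Mn n (a, b') ≤ Mn n (a, b n a)) {ψ : B → ℝ} (hψ : Continuous ψ)
    {γ : ℝ} (hγ : 0 < γ) : ∀ᶠ n in atTop, ∀ a, |ψ (b n a) - ψ (h a)| < γ := by
  have hh : Continuous h := continuous_of_unique_max M.continuous hmax
  have hKclosed : IsClosed {q : A × B | γ ≤ |ψ q.2 - ψ (h q.1)|} :=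
    isClosed_le continuous_const (by fun_prop)
  -- away from the graph of `h`, the criterion `M` falls short of its maximum by a uniform amount
  obtain ⟨c, hc0, hc⟩ := hKclosed.isCompact.exists_forall_le'
    (f := fun q : A × B => M (q.1, h q.1) - M q) (a := 0)
    (Continuous.continuousOn (by fun_prop)) (by
      rintro ⟨x, y⟩ hxy
      have : y ≠ h x := by
        rintro rfl
        simp only [Set.mem_ofPred_eq, sub_self, abs_zero] at hxy
        linarith
      linarith [hmax x y this])
  filter_upwards [Metric.tendsto_nhds.1 hMn (c / 2) (half_pos hc0)] with n hn a
  by_contra! hcon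
  have h1 := hc (a, b n a) hcon
  have h2 := (ContinuousMap.dist_lt_iff (half_pos hc0)).1 hn (a, b n a)
  have h3 := (ContinuousMap.dist_lt_iff (half_pos hc0)).1 hn (a, h a)
  rw [Real.dist_eq, abs_lt] at h2 h3
  have h4 := hb n a (h a)
  simp only at h1
  linarith [h2.2, h3.1]

/-- Approximate minimizers of the plug-in criteria `ψ (b n ·)` are close to minimizers of
`ψ ∘ h`, when the estimates `b n a` maximize criteria which converge uniformly to a criterion
with the unique maximizer `h a`. -/
theorem exists_eventually_dist_minimizer_lt {A B : Type*} [PseudoMetricSpace A] [CompactSpace A]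
    [Nonempty A] [TopologicalSpace B] [CompactSpace B] {M : C(A × B, ℝ)} {h : A → B}
    (hmax : ∀ a b, b ≠ h a → M (a, b) < M (a, h a)) {Mn : ℕ → C(A × B, ℝ)}
    (hMn : Tendsto Mn atTop (𝓝 M)) {b : ℕ → A → B}
    (hb : ∀ n a b', Mn n (a, b') ≤ Mn n (a, b n a)) {ψ : B → ℝ} (hψ : Continuous ψ)
    {ε : ℝ} (hε : 0 < ε) :
    ∃ δ : ℝ, 0 < δ ∧ ∀ᶠ n in atTop, ∀ t, (∀ s, ψ (b n t) ≤ ψ (b n s) + δ) →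
      ∃ t', (∀ s, ψ (h t') ≤ ψ (h s)) ∧ dist t t' < ε := by
  have hg : Continuous fun a => ψ (h a) :=
    hψ.comp (continuous_of_unique_max M.continuous hmax)
  obtain ⟨t₀, -, ht₀⟩ := isCompact_univ.exists_isMinOn Set.univ_nonempty hg.continuousOn
  have ht₀ : ∀ s, ψ (h t₀) ≤ ψ (h s) := fun s => ht₀ (Set.mem_univ s)
  have hKclosed : IsClosed {t : A | ∀ t', (∀ s, ψ (h t') ≤ ψ (h s)) → ε ≤ dist t t'} := by
    simp only [Set.ofPred_forall]
    exact isClosed_iInter fun t' => isClosed_iInter fun _ =>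
      isClosed_le continuous_const (by fun_prop)
  obtain ⟨m, hm0, hm⟩ := hKclosed.isCompact.exists_forall_le' hg.continuousOn (a := ψ (h t₀)) (by
    intro t ht
    by_contra! hcon
    have := ht t fun s => hcon.trans (ht₀ s)
    rw [dist_self] at this
    linarith)
  -- a third of the margin each for the error at `t`, the error at `t₀` and the slack
  refine ⟨(m - ψ (h t₀)) / 3, by linarith, ?_⟩
  filter_upwards [eventually_forall_abs_sub_lt_of_tendsto hmax hMn hb hψ
    (show 0 < (m - ψ (h t₀)) / 3 by linarith)] with n hn t ht
  by_contra! hcon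
  have h1 := hm t hcon
  have h2 := abs_lt.1 (hn t)
  have h3 := abs_lt.1 (hn t₀)
  linarith [ht t₀, h2.1, h3.2]

/-! ### Gaussian densities as exponentials of quadratic polynomials -/

/-- The functions `x ↦ exp (c x² + b x)` are linearly independent: in a nontrivial relation, the
term with lexicographically largest `(c, b)` dominates all others at infinity. -/
theorem linearIndependent_exp_quadratic :
    LinearIndependent ℝ (fun (c : ℝ × ℝ) (x : ℝ) => Real.exp (c.1 * x ^ 2 + c.2 * x)) := by
  have hlim : ∀ a b : ℝ, (a < 0 ∨ a = 0 ∧ b < 0) →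
      Tendsto (fun x : ℝ => Real.exp (a * x ^ 2 + b * x)) atTop (𝓝 0) := by
    intro a b hab
    refine Real.tendsto_exp_atBot.comp ?_
    have hlin : Tendsto (fun x : ℝ => x * (a * x + b)) atTop atBot := by
      rcases hab with ha | ⟨rfl, hb⟩
      · exact tendsto_id.atTop_mul_atBot₀
          (tendsto_atBot_add_const_right _ b (tendsto_id.const_mul_atTop_of_neg ha))
      · simpa using tendsto_id.atTop_mul_const_of_neg hb
    refine hlin.congr fun x => by ring
  rw [linearIndependent_iff']
  intro s g hg i hi
  by_contra hgi
  obtain ⟨m, hm, hmax⟩ := (s.filter fun j => g j ≠ 0).exists_max_image toLex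
    ⟨i, Finset.mem_filter.2 ⟨hi, hgi⟩⟩
  rw [Finset.mem_filter] at hm
  -- the relation divided by its dominant exponential
  have hzero : ∀ x : ℝ, ∑ j ∈ s, g j *
      Real.exp ((j.1 - m.1) * x ^ 2 + (j.2 - m.2) * x) = 0 := by
    intro x
    have h1 := congrFun hg x
    simp only [Finset.sum_apply, Pi.smul_apply, smul_eq_mul, Pi.zero_apply] at h1
    have h2 : ∑ j ∈ s, g j * Real.exp ((j.1 - m.1) * x ^ 2 + (j.2 - m.2) * x) =
        Real.exp (-(m.1 * x ^ 2 + m.2 * x)) *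
          ∑ j ∈ s, g j * Real.exp (j.1 * x ^ 2 + j.2 * x) := by
      rw [Finset.mul_sum]
      refine Finset.sum_congr rfl fun j _ => ?_
      rw [mul_left_comm, ← Real.exp_add]
      congr 2
      ring
    rw [h2, h1, mul_zero]
  have htend : Tendsto (fun x : ℝ => ∑ j ∈ s, g j *
      Real.exp ((j.1 - m.1) * x ^ 2 + (j.2 - m.2) * x)) atTop
      (𝓝 (∑ j ∈ s, if j = m then g m else 0)) := by
    refine tendsto_finsetSum _ fun j hj => ?_
    by_cases hjm : j = m
    · subst hjm
      simp
    · rw [if_neg hjm]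
      by_cases hgj : g j = 0
      · simp [hgj]
      · have hle := hmax j (Finset.mem_filter.2 ⟨hj, hgj⟩)
        rw [Prod.Lex.toLex_le_toLex] at hle
        have hlt : j.1 - m.1 < 0 ∨ j.1 - m.1 = 0 ∧ j.2 - m.2 < 0 := by
          rcases hle with h | ⟨h, h'⟩
          · exact Or.inl (sub_neg.2 h)
          · refine Or.inr ⟨sub_eq_zero.2 h, sub_neg.2 (lt_of_le_of_ne h' fun h'' => ?_)⟩
            exact hjm (Prod.ext h h'')
        simpa using (hlim _ _ hlt).const_mul (g j)
  simp only [hzero, Finset.sum_ite_eq', hm.1, if_true] at htend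
  exact hm.2 (tendsto_nhds_unique htend tendsto_const_nhds)

/-- The Gaussian density with positive standard deviation in its natural parameters. -/
theorem gaussianPDFReal_sq_eq_exp {μ σ : ℝ} (hσ : 0 < σ) (x : ℝ) :
    gaussianPDFReal μ (Real.toNNReal (σ ^ 2)) x =
      Real.exp (-(μ ^ 2 / (2 * σ ^ 2)) - Real.log (√(2 * Real.pi) * σ)) *
        Real.exp (-(1 / (2 * σ ^ 2)) * x ^ 2 + μ / σ ^ 2 * x) := by
  have hpos : 0 < √(2 * Real.pi) * σ := by positivity
  rw [gaussianPDFReal, Real.coe_toNNReal _ (sq_nonneg σ), Real.sqrt_mul (by positivity),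
    Real.sqrt_sq hσ.le, sub_eq_add_neg (-_) (Real.log _), Real.exp_add, Real.exp_neg (Real.log _),
    Real.exp_log hpos, mul_comm (Real.exp _) _, mul_assoc, ← Real.exp_add]
  congr 2
  field_simp
  ring

/-- The three coefficients of the log-density depend continuously on `(μ, σ)`. -/
theorem continuousOn_natural_parameters :
    ContinuousOn (fun c : ℝ × ℝ =>
      -(c.1 ^ 2 / (2 * c.2 ^ 2)) - Real.log (√(2 * Real.pi) * c.2)) {c | 0 < c.2} ∧
    ContinuousOn (fun c : ℝ × ℝ => c.1 / c.2 ^ 2) {c | 0 < c.2} ∧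
    ContinuousOn (fun c : ℝ × ℝ => -(1 / (2 * c.2 ^ 2))) {c | 0 < c.2} := by
  have hsq : ∀ c ∈ {c : ℝ × ℝ | 0 < c.2}, c.2 ^ 2 ≠ 0 := fun c (hc : 0 < c.2) => by positivity
  have hsq2 : ∀ c ∈ {c : ℝ × ℝ | 0 < c.2}, 2 * c.2 ^ 2 ≠ 0 := fun c (hc : 0 < c.2) => by
    positivity
  refine ⟨ContinuousOn.sub (ContinuousOn.neg (ContinuousOn.div (by fun_prop) (by fun_prop) hsq2))
    (ContinuousOn.log (by fun_prop) fun c (hc : 0 < c.2) => by positivity),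
    ContinuousOn.div (by fun_prop) (by fun_prop) hsq,
    ContinuousOn.neg (ContinuousOn.div (by fun_prop) (by fun_prop) hsq2)⟩

/-- The densities of pairwise distinct nondegenerate normal laws are linearly independent. -/
theorem linearIndependent_gaussianPDFReal :
    LinearIndependent ℝ (fun (c : {c : ℝ × ℝ // 0 < c.2}) (x : ℝ) =>
      gaussianPDFReal c.1.1 (Real.toNNReal (c.1.2 ^ 2)) x) := by
  have hinj : Function.Injective (fun c : {c : ℝ × ℝ // 0 < c.2} =>
      ((-(1 / (2 * c.1.2 ^ 2)), c.1.1 / c.1.2 ^ 2) : ℝ × ℝ)) := by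
    rintro ⟨⟨μ, σ⟩, hσ⟩ ⟨⟨μ', σ'⟩, hσ'⟩ h
    simp only [Prod.mk.injEq, neg_inj] at h hσ hσ'
    obtain ⟨h1, h2⟩ := h
    have h3 : σ ^ 2 = σ' ^ 2 := by
      have : (0 : ℝ) < σ ^ 2 := by positivity
      have : (0 : ℝ) < σ' ^ 2 := by positivity
      field_simp at h1
      linarith
    have h4 : σ = σ' := by
      rwa [sq_eq_sq₀ hσ.le hσ'.le] at h3
    subst h4
    have h5 : μ = μ' := by
      have : (0 : ℝ) < σ ^ 2 := by positivity
      field_simp at h2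
      exact h2
    subst h5
    rfl
  convert (linearIndependent_exp_quadratic.comp _ hinj).units_smul (fun c =>
    Units.mk0 (Real.exp (-(c.1.1 ^ 2 / (2 * c.1.2 ^ 2)) - Real.log (√(2 * Real.pi) * c.1.2)))
      (Real.exp_pos _).ne') using 1
  funext c x
  rw [gaussianPDFReal_sq_eq_exp c.2]
  rfl

/-! ### The two-component mixture with known unequal weights -/

/-- The density `∑_y π_y N(x; μ_y, σ_y²)` of the Gaussian mixture. -/
noncomputable def mixturePDF (π : ℤˣ → ℝ) (η : MixParams) (x : ℝ) : ℝ :=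
  ∑ y : ℤˣ, π y * componentPDF η y x

theorem sum_units_int {M : Type*} [AddCommMonoid M] (f : ℤˣ → M) : ∑ y, f y = f 1 + f (-1) := by
  rw [UnitsInt.univ, Finset.sum_pair (by decide)]

/-- Identifiability: a mixture with known unequal positive weights determines the parameters of
both components. -/
theorem mixturePDF_injOn {π : ℤˣ → ℝ} (hπ : ∀ y, 0 < π y) (hne : π 1 ≠ π (-1)) :
    Set.InjOn (mixturePDF π) {η | ∀ y, 0 < (η y).2} := by
  intro η hη η' hη' h
  let c : ℤˣ → {c : ℝ × ℝ // 0 < c.2} := fun y => ⟨η y, hη y⟩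
  let c' : ℤˣ → {c : ℝ × ℝ // 0 < c.2} := fun y => ⟨η' y, hη' y⟩
  have hinj := linearIndependent_gaussianPDFReal.finsuppLinearCombination_injective
  have key : Finsupp.single (c 1) (π 1) + Finsupp.single (c (-1)) (π (-1)) =
      Finsupp.single (c' 1) (π 1) + Finsupp.single (c' (-1)) (π (-1)) := by
    apply hinj
    funext x
    have := congrFun h x
    simp only [mixturePDF, sum_units_int, componentPDF] at this
    simpa [c, c'] using this
  have e1 := DFunLike.congr_fun key (c 1)
  have e2 := DFunLike.congr_fun key (c (-1))
  have e3 := DFunLike.congr_fun key (c' 1)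
  have e4 := DFunLike.congr_fun key (c' (-1))
  simp only [Finsupp.add_apply, Finsupp.single_apply] at e1 e2 e3 e4
  have hp1 := hπ 1
  have hp2 := hπ (-1)
  -- comparing masses at the four atoms, a swap of the components would force equal weights
  have hcc : c 1 = c' 1 ∧ c (-1) = c' (-1) := by
    grind
  funext y
  rcases Int.units_eq_one_or y with rfl | rfl
  · exact congrArg Subtype.val hcc.1
  · exact congrArg Subtype.val hcc.2

theorem componentPDF_pos {η : MixParams} {y : ℤˣ} (hη : 0 < (η y).2) (x : ℝ) :
    0 < componentPDF η y x :=
  gaussianPDFReal_pos _ _ _ (by simpa using hη.ne')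

theorem mixturePDF_pos {π : ℤˣ → ℝ} (hπ : ∀ y, 0 < π y) {η : MixParams}
    (hη : ∀ y, 0 < (η y).2) (x : ℝ) : 0 < mixturePDF π η x :=
  Finset.sum_pos (fun y _ => mul_pos (hπ y) (componentPDF_pos (hη y) x)) Finset.univ_nonempty

theorem continuousOn_componentPDF (y : ℤˣ) :
    ContinuousOn (fun q : MixParams × ℝ => componentPDF q.1 y q.2) {q | 0 < (q.1 y).2} := by
  have : Set.EqOn (fun q : MixParams × ℝ => componentPDF q.1 y q.2) (fun q =>
      Real.exp (-((q.1 y).1 ^ 2 / (2 * (q.1 y).2 ^ 2)) - Real.log (√(2 * Real.pi) * (q.1 y).2)) *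
        Real.exp (-(1 / (2 * (q.1 y).2 ^ 2)) * q.2 ^ 2 + (q.1 y).1 / (q.1 y).2 ^ 2 * q.2))
      {q | 0 < (q.1 y).2} := fun q hq => gaussianPDFReal_sq_eq_exp hq q.2
  refine ContinuousOn.congr ?_ this
  have hmaps : Set.MapsTo (fun q : MixParams × ℝ => q.1 y) {q | 0 < (q.1 y).2} {c | 0 < c.2} :=
    fun q hq => hq
  have hc : Continuous fun q : MixParams × ℝ => q.1 y := by fun_prop
  obtain ⟨h0, h1, h2⟩ := continuousOn_natural_parameters
  exact (h0.comp hc.continuousOn hmaps).rexp.mul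
    (((h2.comp hc.continuousOn hmaps).mul (by fun_prop)).add
      ((h1.comp hc.continuousOn hmaps).mul (by fun_prop))).rexp

theorem continuousOn_mixturePDF (π : ℤˣ → ℝ) :
    ContinuousOn (fun q : MixParams × ℝ => mixturePDF π q.1 q.2) {q | ∀ y, 0 < (q.1 y).2} :=
  continuousOn_finsetSum _ fun y _ => continuousOn_const.mul
    ((continuousOn_componentPDF y).mono fun _ hq => hq y)

theorem continuous_mixturePDF (π : ℤˣ → ℝ) {η : MixParams} (hη : ∀ y, 0 < (η y).2) :
    Continuous (mixturePDF π η) := by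
  rw [← continuousOn_univ]
  exact (continuousOn_mixturePDF π).comp (f := fun x => (η, x)) (by fun_prop) fun _ _ => hη

theorem integrable_componentPDF (η : MixParams) (y : ℤˣ) : Integrable (componentPDF η y) :=
  integrable_gaussianPDFReal _ _

theorem integrable_mixturePDF (π : ℤˣ → ℝ) (η : MixParams) : Integrable (mixturePDF π η) :=
  integrable_finsetSum _ fun y _ => (integrable_componentPDF η y).const_mul _

theorem integral_mixturePDF {π : ℤˣ → ℝ} (hπ1 : ∑ y, π y = 1) {η : MixParams}
    (hη : ∀ y, 0 < (η y).2) : ∫ x, mixturePDF π η x = 1 := by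
  unfold mixturePDF
  rw [integral_finsetSum _ fun y _ => (integrable_componentPDF η y).const_mul _, ← hπ1]
  refine Finset.sum_congr rfl fun y _ => ?_
  rw [integral_const_mul]
  unfold componentPDF
  rw [integral_gaussianPDFReal_eq_one _ (by simpa using (hη y).ne'), mul_one]

/-- Over a compact parameter set, the log-density of the mixture grows at most quadratically. -/
theorem exists_abs_log_mixturePDF_le {π : ℤˣ → ℝ} (hπ : ∀ y, 0 < π y) (hπ1 : ∑ y, π y = 1)
    {E : Set MixParams} (hE : IsCompact E) (hEpos : ∀ η ∈ E, ∀ y, 0 < (η y).2) :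
    ∃ C : ℝ, ∀ η ∈ E, ∀ x, |Real.log (mixturePDF π η x)| ≤ C * (1 + x ^ 2) := by
  have hcomp : ∀ y, ∃ C : ℝ, ∀ η ∈ E, ∀ x, |Real.log (componentPDF η y x)| ≤ C * (1 + x ^ 2) := by
    intro y
    have hmaps : Set.MapsTo (fun η : MixParams => η y) E {c | 0 < c.2} := fun η hη => hEpos η hη y
    have hc : Continuous fun η : MixParams => η y := by fun_prop
    obtain ⟨h0, h1, h2⟩ := continuousOn_natural_parameters
    obtain ⟨A, hA⟩ := hE.exists_bound_of_continuousOn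
      (f := fun η : MixParams => -((η y).1 ^ 2 / (2 * (η y).2 ^ 2)) -
        Real.log (√(2 * Real.pi) * (η y).2)) (h0.comp hc.continuousOn hmaps)
    obtain ⟨B, hB⟩ := hE.exists_bound_of_continuousOn
      (f := fun η : MixParams => (η y).1 / (η y).2 ^ 2) (h1.comp hc.continuousOn hmaps)
    obtain ⟨G, hG⟩ := hE.exists_bound_of_continuousOn
      (f := fun η : MixParams => -(1 / (2 * (η y).2 ^ 2))) (h2.comp hc.continuousOn hmaps)
    refine ⟨A + B + G, fun η hη x => ?_⟩
    have hA := hA η hη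
    have hB := hB η hη
    have hG := hG η hη
    rw [Real.norm_eq_abs] at hA hB hG
    unfold componentPDF
    rw [gaussianPDFReal_sq_eq_exp (hEpos η hη y), ← Real.exp_add, Real.log_exp]
    refine (abs_add_le _ _).trans ((add_le_add hA (abs_add_le _ _)).trans ?_)
    rw [abs_mul, abs_mul, abs_pow, sq_abs]
    have hA0 := (abs_nonneg _).trans hA
    have hB0 := (abs_nonneg _).trans hB
    have hG0 := (abs_nonneg _).trans hG
    have hx : |x| ≤ 1 + x ^ 2 := by nlinarith [sq_abs x, sq_nonneg (|x| - 1), abs_nonneg x]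
    have h1 := mul_le_mul hB hx (abs_nonneg x) hB0
    have h2 := mul_le_mul_of_nonneg_right hG (sq_nonneg x)
    nlinarith [mul_nonneg hA0 (sq_nonneg x)]
  choose C hC using hcomp
  refine ⟨max (C 1) (C (-1)), fun η hη x => ?_⟩
  have hT : ∀ y, |Real.log (componentPDF η y x)| ≤ max (C 1) (C (-1)) * (1 + x ^ 2) := by
    intro y
    refine (hC y η hη x).trans (mul_le_mul_of_nonneg_right ?_ (by positivity))
    rcases Int.units_eq_one_or y with rfl | rfl
    · exact le_max_left _ _
    · exact le_max_right _ _
  set T := max (C 1) (C (-1)) * (1 + x ^ 2)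
  -- the mixture density is an average of component densities, all of them in `[exp (-T), exp T]`
  have hcp := fun y => componentPDF_pos (hEpos η hη y) x
  have hmp := mixturePDF_pos hπ (hEpos η hη) x
  rw [abs_le]
  constructor
  · rw [Real.le_log_iff_exp_le hmp]
    calc Real.exp (-T) = ∑ y, π y * Real.exp (-T) := by rw [← Finset.sum_mul, hπ1, one_mul]
      _ ≤ mixturePDF π η x := Finset.sum_le_sum fun y _ => mul_le_mul_of_nonneg_left
          ((Real.le_log_iff_exp_le (hcp y)).1 (abs_le.1 (hT y)).1) (hπ y).le
  · rw [Real.log_le_iff_le_exp hmp]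
    calc mixturePDF π η x ≤ ∑ y, π y * Real.exp T :=
          Finset.sum_le_sum fun y _ => mul_le_mul_of_nonneg_left
          ((Real.log_le_iff_le_exp (hcp y)).1 (abs_le.1 (hT y)).2) (hπ y).le
      _ = Real.exp T := by rw [← Finset.sum_mul, hπ1, one_mul]

/-- Gibbs' inequality, strict for distinct continuous positive densities. -/
theorem integral_mul_log_lt_of_ne {q r : ℝ → ℝ} (hq : Continuous q) (hr : Continuous r)
    (hq0 : ∀ x, 0 < q x) (hr0 : ∀ x, 0 < r x) (hqi : Integrable q) (hri : Integrable r)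
    (hqr : ∫ x, q x = ∫ x, r x) (hqq : Integrable fun x => q x * Real.log (q x))
    (hqlr : Integrable fun x => q x * Real.log (r x)) (hne : r ≠ q) :
    ∫ x, q x * Real.log (r x) < ∫ x, q x * Real.log (q x) := by
  -- `D` is nonnegative by `log u ≤ u - 1` for `u = r / q`, with equality only where `r = q`;
  -- its integral is the difference of the two sides because `q` and `r` have equal mass
  set D : ℝ → ℝ := fun x => (r x - q x) - (q x * Real.log (r x) - q x * Real.log (q x)) with hD
  have hlog : ∀ x, D x = q x * (r x / q x - 1 - Real.log (r x / q x)) := by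
    intro x
    have := (hq0 x).ne'
    rw [Real.log_div (hr0 x).ne' this, hD]
    field_simp
  have hDnn : ∀ x, 0 ≤ D x := fun x => by
    rw [hlog]
    exact mul_nonneg (hq0 x).le (by
      linarith [Real.log_le_sub_one_of_pos (div_pos (hr0 x) (hq0 x))])
  have hDc : Continuous D := (hr.sub hq).sub
    ((hq.mul (hr.log fun x => (hr0 x).ne')).sub (hq.mul (hq.log fun x => (hq0 x).ne')))
  have hDi : Integrable D := (hri.sub hqi).sub (hqlr.sub hqq)
  have hpos : 0 < ∫ x, D x := by
    rw [integral_pos_iff_support_of_nonneg hDnn hDi]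
    refine hDc.isOpen_support.measure_pos _ ?_
    obtain ⟨x, hx⟩ := Function.ne_iff.1 hne
    refine ⟨x, ?_⟩
    rw [Function.mem_support, hlog]
    refine mul_ne_zero (hq0 x).ne' (ne_of_gt ?_)
    have h1 : r x / q x ≠ 1 := fun h => hx ((div_eq_one_iff_eq (hq0 x).ne').1 h)
    linarith [Real.log_lt_sub_one_of_pos (div_pos (hr0 x) (hq0 x)) h1]
  have hint : ∫ x, D x = (∫ x, r x) - (∫ x, q x) -
      ((∫ x, q x * Real.log (r x)) - ∫ x, q x * Real.log (q x)) := by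
    rw [← integral_sub hri hqi, ← integral_sub hqlr hqq]
    exact integral_sub (hri.sub hqi) (hqlr.sub hqq)
  rw [hint] at hpos
  linarith

/-! ### The joint law as a mixture of the class-conditional laws -/

/-- The σ-algebra of `ℤˣ` is pulled back from `ℤ` along the injective coercion. -/
instance : DiscreteMeasurableSpace ℤˣ where
  forall_measurableSet s :=
    ⟨Units.val '' s, .of_discrete, Set.preimage_image_eq s Units.val_injective⟩

theorem score_add {d : ℕ} (θ θ' x : EuclideanSpace ℝ (Fin d)) :
    score (θ + θ') x = score θ x + score θ' x := by
  simp [score, add_mul, Finset.sum_add_distrib]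

theorem score_smul {d : ℕ} (c : ℝ) (θ x : EuclideanSpace ℝ (Fin d)) :
    score (c • θ) x = c * score θ x := by
  simp [score, mul_assoc, Finset.mul_sum]

theorem continuous_uncurry_score {d : ℕ} :
    Continuous fun q : EuclideanSpace ℝ (Fin d) × EuclideanSpace ℝ (Fin d) => score q.1 q.2 := by
  unfold score
  fun_prop

theorem continuous_score {d : ℕ} (θ : EuclideanSpace ℝ (Fin d)) : Continuous (score θ) :=
  continuous_uncurry_score.comp (by fun_prop : Continuous fun x => (θ, x))

section Conditioning

variable {d : ℕ} {p : Measure (EuclideanSpace ℝ (Fin d) × ℤˣ)} [IsProbabilityMeasure p]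
  {θ : EuclideanSpace ℝ (Fin d)} {η : MixParams}

/-- A class of probability zero has the zero measure as its conditional law, which is not
normal. -/
theorem labelMarginal_pos_of_scoreLaw_eq
    (hlaw : ∀ y, scoreLaw p θ y = gaussianReal (η y).1 (Real.toNNReal ((η y).2 ^ 2))) (y : ℤˣ) :
    0 < labelMarginal p y := by
  refine lt_of_le_of_ne measureReal_nonneg fun h => ?_
  have h0 : p {z | z.2 = y} = 0 := (measureReal_eq_zero_iff).1 h.symm
  have h1 := hlaw y
  rw [scoreLaw, cond_eq_zero_of_meas_eq_zero h0, Measure.map_zero] at h1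
  exact IsProbabilityMeasure.ne_zero (gaussianReal (η y).1 (Real.toNNReal ((η y).2 ^ 2))) h1.symm

theorem sum_labelMarginal : ∑ y, labelMarginal p y = 1 := by
  have := sum_measureReal_preimage_singleton (μ := p) (f := Prod.snd) (Finset.univ : Finset ℤˣ)
    fun y _ => measurable_snd (measurableSet_singleton y)
  rw [Finset.coe_univ, Set.preimage_univ, probReal_univ] at this
  exact this

/-- Expectations of functions of the score and the label, when the conditional laws of the score
are normal. -/
theorem integrable_and_integral_of_scoreLaw_eq (hη : ∀ y, 0 < (η y).2)
    (hlaw : ∀ y, scoreLaw p θ y = gaussianReal (η y).1 (Real.toNNReal ((η y).2 ^ 2)))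
    {f : ℤˣ → ℝ → ℝ} (hf : ∀ y, Measurable (f y))
    (hfi : ∀ y, Integrable (f y) (gaussianReal (η y).1 (Real.toNNReal ((η y).2 ^ 2)))) :
    Integrable (fun z => f z.2 (score θ z.1)) p ∧
      ∫ z, f z.2 (score θ z.1) ∂p =
        ∑ y, labelMarginal p y * ∫ x, componentPDF η y x * f y x := by
  have hsc : Measurable fun z : EuclideanSpace ℝ (Fin d) × ℤˣ => score θ z.1 :=
    (continuous_score θ).measurable.comp measurable_fst
  have hae : ∀ y, (fun z => f z.2 (score θ z.1)) =ᵐ[cond p (Prod.snd ⁻¹' {y})]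
      fun z => f y (score θ z.1) := fun y => by
    filter_upwards [ae_cond_mem (μ := p) (measurable_snd (measurableSet_singleton y))] with z hz
    rw [show z.2 = y from hz]
  have hint : ∀ y, Integrable (fun z => f z.2 (score θ z.1)) (cond p (Prod.snd ⁻¹' {y})) := by
    intro y
    rw [integrable_congr (hae y)]
    have := hfi y
    rw [← hlaw y] at this
    exact (integrable_map_measure (hf y).aestronglyMeasurable hsc.aemeasurable).1 this
  have hint' : ∀ y ∈ (Finset.univ : Finset ℤˣ), Integrable (fun z => f z.2 (score θ z.1))
      (p (Prod.snd ⁻¹' {y}) • cond p (Prod.snd ⁻¹' {y})) := fun y _ =>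
    (hint y).smul_measure (measure_ne_top _ _)
  have hsum := sum_meas_smul_cond_fiber (X := (Prod.snd : EuclideanSpace ℝ (Fin d) × ℤˣ → ℤˣ))
    measurable_snd p
  constructor
  · rw [← hsum]
    exact integrable_finsetSum_measure.2 hint'
  · conv_lhs => rw [← hsum]
    rw [integral_finsetSum_measure hint']
    refine Finset.sum_congr rfl fun y _ => ?_
    rw [integral_smul_measure, smul_eq_mul, integral_congr_ae (hae y)]
    congr 1
    have h1 : ∫ x, f y x ∂(scoreLaw p θ y) =
        ∫ z, f y (score θ z.1) ∂(cond p (Prod.snd ⁻¹' {y})) :=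
      integral_map hsc.aemeasurable (hf y).aestronglyMeasurable
    rw [← h1, hlaw y, integral_gaussianReal_eq_integral_smul (by simpa using (hη y).ne')]
    rfl

end Conditioning

/-! ### Losses dominated by the exponential loss -/

/-- All three losses are continuous, nonnegative and at most the exponential loss, by
`log (1 + u) ≤ u` and `1 - u ≤ exp (-u)`. -/
theorem continuous_and_bounds_of_loss {L : ℤˣ → ℝ → ℝ}
    (hL : L = expLoss ∨ L = logLoss ∨ L = hingeLoss) (y : ℤˣ) :
    Continuous (L y) ∧ ∀ α, 0 ≤ L y α ∧ L y α ≤ Real.exp (-(labelVal y * α)) := by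
  rcases hL with rfl | rfl | rfl
  · exact ⟨by unfold expLoss; fun_prop, fun α => ⟨(Real.exp_pos _).le, le_rfl⟩⟩
  · have hpos : ∀ α, 0 < Real.exp (-(labelVal y * α)) := fun α => Real.exp_pos _
    refine ⟨?_, fun α => ⟨Real.log_nonneg (by linarith [hpos α]), ?_⟩⟩
    · unfold logLoss
      exact Continuous.log (by fun_prop) fun α => by linarith [hpos α]
    · have := Real.log_le_sub_one_of_pos (show 0 < 1 + Real.exp (-(labelVal y * α)) by
        linarith [hpos α])
      unfold logLoss
      linarith
  · refine ⟨by unfold hingeLoss; fun_prop, fun α => ⟨le_max_right _ _, ?_⟩⟩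
    exact max_le (by linarith [Real.add_one_le_exp (-(labelVal y * α))]) (Real.exp_pos _).le

theorem abs_labelVal (y : ℤˣ) : |labelVal y| = 1 := by
  rcases Int.units_eq_one_or y with rfl | rfl <;> simp [labelVal]

theorem integrable_loss_gaussianReal {L : ℤˣ → ℝ → ℝ}
    (hL : L = expLoss ∨ L = logLoss ∨ L = hingeLoss) (y : ℤˣ) (m : ℝ) (v : NNReal) :
    Integrable (L y) (gaussianReal m v) := by
  obtain ⟨hc, hb⟩ := continuous_and_bounds_of_loss hL y
  refine (integrable_exp_mul_gaussianReal (-labelVal y)).mono' hc.aestronglyMeasurable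
    (Eventually.of_forall fun α => ?_)
  rw [Real.norm_of_nonneg (hb α).1, neg_mul]
  exact (hb α).2

/-- An expectation under a component, written over a standard normal variable so that the
parameters enter through the integrand only. -/
theorem integral_componentPDF_mul_eq {η : MixParams} {y : ℤˣ} (hη : 0 < (η y).2)
    {f : ℝ → ℝ} (hf : Continuous f) :
    ∫ α, componentPDF η y α * f α = ∫ u, f ((η y).2 * u + (η y).1) ∂(gaussianReal 0 1) := by
  have hmap : (gaussianReal 0 1).map (fun u => (η y).2 * u + (η y).1) =
      gaussianReal (η y).1 (Real.toNNReal ((η y).2 ^ 2)) := by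
    have h := (Measure.map_map (μ := gaussianReal 0 1) (measurable_add_const (η y).1)
      (measurable_const_mul (η y).2)).symm
    rw [gaussianReal_map_const_mul, gaussianReal_map_add_const] at h
    refine Eq.trans h ?_
    congr 1
    · simp
    · ext
      simp [sq_nonneg]
  rw [← integral_map (φ := fun u => (η y).2 * u + (η y).1) (by fun_prop)
    hf.aestronglyMeasurable, hmap,
    integral_gaussianReal_eq_integral_smul (by simpa using hη.ne')]
  rfl

theorem continuous_plugInRisk {L : ℤˣ → ℝ → ℝ}
    (hL : L = expLoss ∨ L = logLoss ∨ L = hingeLoss) (π : ℤˣ → ℝ)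
    {E : Set MixParams} (hE : IsCompact E) (hEpos : ∀ η ∈ E, ∀ y, 0 < (η y).2) :
    Continuous fun η : E => plugInRisk π L η := by
  unfold plugInRisk
  refine continuous_finsetSum _ fun y _ => continuous_const.mul ?_
  obtain ⟨hc, hb⟩ := continuous_and_bounds_of_loss hL y
  have heq : (fun η : E => ∫ α, componentPDF η y α * L y α) =
      fun η : E => ∫ u, L y ((η.1 y).2 * u + (η.1 y).1) ∂(gaussianReal 0 1) :=
    funext fun η => integral_componentPDF_mul_eq (hEpos η η.2 y) hc
  rw [heq]
  obtain ⟨B, hB⟩ := hE.exists_bound_of_continuousOn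
    (f := fun η : MixParams => η y) (by fun_prop)
  have hy : Continuous fun η : E => η.1 y := (continuous_apply y).comp continuous_subtype_val
  refine continuous_of_dominated
    (bound := fun u => Real.exp B * (Real.exp (B * u) + Real.exp (-B * u)))
    (fun η => (by fun_prop : Continuous fun u : ℝ =>
      L y ((η.1 y).2 * u + (η.1 y).1)).aestronglyMeasurable)
    (fun η => Eventually.of_forall fun u => ?_)
    (((integrable_exp_mul_gaussianReal B).add (integrable_exp_mul_gaussianReal (-B))).const_mul _)
    (Eventually.of_forall fun u =>
      hc.comp ((hy.snd.mul continuous_const).add hy.fst))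
  rw [Real.norm_of_nonneg (hb _).1]
  refine (hb _).2.trans ?_
  have hη := hB η.1 η.2
  have h1 : |(η.1 y).1| ≤ B := (norm_fst_le _).trans hη
  have h2 : |(η.1 y).2| ≤ B := (norm_snd_le _).trans hη
  have h3 : -(labelVal y * ((η.1 y).2 * u + (η.1 y).1)) ≤ B + B * |u| := by
    refine (neg_le_abs _).trans ?_
    rw [abs_mul, abs_labelVal, one_mul]
    refine (abs_add_le _ _).trans ?_
    rw [abs_mul, add_comm]
    exact add_le_add h1 (mul_le_mul_of_nonneg_right h2 (abs_nonneg u))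
  refine (Real.exp_le_exp.2 h3).trans ?_
  rw [Real.exp_add]
  refine mul_le_mul_of_nonneg_left ?_ (Real.exp_pos _).le
  rcases abs_cases u with ⟨h, -⟩ | ⟨h, -⟩ <;> rw [h]
  · exact le_add_of_nonneg_right (Real.exp_pos _).le
  · rw [mul_neg, ← neg_mul]
    exact le_add_of_nonneg_left (Real.exp_pos _).le

/-! ### Uniform law of large numbers for the log-likelihood -/

/-- If all scores `f_θ`, `θ ∈ Θ`, are square-integrable, then `f_θ²` has an integrable envelope
over the bounded set `Θ`: the parameters with square-integrable score form a linear subspace, and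
an orthonormal basis of it bounds all scores at once by the Cauchy-Schwarz inequality. -/
theorem exists_integrable_sq_score_le {d : ℕ} {ν : Measure (EuclideanSpace ℝ (Fin d))}
    {Θ : Set (EuclideanSpace ℝ (Fin d))} (hΘ : Bornology.IsBounded Θ)
    (h : ∀ θ ∈ Θ, MemLp (score θ) 2 ν) :
    ∃ G : EuclideanSpace ℝ (Fin d) → ℝ, Integrable G ν ∧ ∀ θ ∈ Θ, ∀ x, score θ x ^ 2 ≤ G x := by
  let V : Submodule ℝ (EuclideanSpace ℝ (Fin d)) :=
    { carrier := {θ | MemLp (score θ) 2 ν}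
      add_mem' := fun {θ θ'} h h' => by
        have : score (θ + θ') = score θ + score θ' := funext (score_add θ θ')
        simp only [Set.mem_ofPred_eq] at h h' ⊢
        rw [this]
        exact h.add h'
      zero_mem' := by
        have : score (0 : EuclideanSpace ℝ (Fin d)) = fun _ => 0 := by
          funext x
          simp [score]
        simp only [Set.mem_ofPred_eq]
        rw [this]
        exact MemLp.zero
      smul_mem' := fun c θ h => by
        have : score (c • θ) = fun x => c * score θ x := funext (score_smul c θ)
        simp only [Set.mem_ofPred_eq] at h ⊢
        rw [this]
        exact h.const_mul c }
  obtain ⟨C, hC⟩ := hΘ.exists_norm_le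
  let b := stdOrthonormalBasis ℝ V
  refine ⟨fun x => C ^ 2 * ∑ i, score (b i : EuclideanSpace ℝ (Fin d)) x ^ 2,
    (integrable_finsetSum _ fun i _ => MemLp.integrable_sq (b i).2).const_mul _,
    fun θ hθ x => ?_⟩
  let v : V := ⟨θ, h θ hθ⟩
  have hlin : ∀ w : V, score (w : EuclideanSpace ℝ (Fin d)) x =
      ((⟨⟨fun w : V => score (w : EuclideanSpace ℝ (Fin d)) x, fun w w' => score_add _ _ _⟩,
        fun c w => score_smul c _ _⟩ : V →ₗ[ℝ] ℝ)) w := fun w => rfl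
  have hexp : score θ x = ∑ i, inner ℝ (b i) v * score (b i : EuclideanSpace ℝ (Fin d)) x := by
    calc score θ x = score (v : EuclideanSpace ℝ (Fin d)) x := rfl
      _ = score ((∑ i, inner ℝ (b i) v • b i : V) : EuclideanSpace ℝ (Fin d)) x := by
        rw [b.sum_repr' v]
      _ = _ := by
        rw [hlin, map_sum]
        simp only [map_smul, smul_eq_mul]
        rfl
  have hnorm : ∑ i, inner ℝ (b i) v ^ 2 ≤ C ^ 2 := by
    have h1 := b.sum_sq_norm_inner_right v
    simp only [Real.norm_eq_abs, sq_abs] at h1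
    rw [h1]
    exact pow_le_pow_left₀ (norm_nonneg _) (hC θ hθ) 2
  rw [hexp]
  exact (Finset.sum_mul_sq_le_sq_mul_sq _ _ _).trans
    (mul_le_mul_of_nonneg_right hnorm (Finset.sum_nonneg fun i _ => sq_nonneg _))

/-- Uniform strong law of large numbers: for a family of functions indexed continuously by a
compact space and dominated by an integrable function, it is the strong law in the separable
Banach space `C(K, ℝ)`. -/
theorem exists_ae_tendsto_average_continuousMap {S K Ω : Type*} [TopologicalSpace S]
    [MeasurableSpace S] [OpensMeasurableSpace S] [TopologicalSpace K] [CompactSpace K]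
    [SecondCountableTopology K] [T2Space K] {ν : Measure S} (F : C(S, C(K, ℝ))) {G : S → ℝ}
    (hG : Integrable G ν) (hFG : ∀ x k, |F x k| ≤ G x)
    [MeasurableSpace Ω] {P : Measure Ω} {X : ℕ → Ω → S}
    (hXmeas : ∀ i, Measurable (X i)) (hXindep : iIndepFun X P) (hXlaw : ∀ i, P.map (X i) = ν) :
    ∃ M : C(K, ℝ), (∀ k, M k = ∫ x, F x k ∂ν) ∧ ∀ᵐ ω ∂P,
      Tendsto (fun n : ℕ => (n : ℝ)⁻¹ • ∑ i ∈ Finset.range n, F (X i ω)) atTop (𝓝 M) := by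
  borelize C(K, ℝ)
  have hFm : Measurable F := F.continuous.measurable
  have hFi : Integrable F ν := hG.mono hFm.aestronglyMeasurable (Eventually.of_forall fun x =>
    (ContinuousMap.norm_le _ (norm_nonneg _)).2 fun k => (hFG x k).trans (le_abs_self _))
  have hFXi : Integrable (fun ω => F (X 0 ω)) P := by
    rw [← hXlaw 0] at hFi
    exact (integrable_map_measure hFm.aestronglyMeasurable (hXmeas 0).aemeasurable).1 hFi
  have hslln := strong_law_ae (μ := P) (fun i ω => F (X i ω)) hFXi
    (fun i j hij => (hXindep.indepFun hij).comp hFm hFm)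
    (fun i => ⟨(hFm.comp (hXmeas i)).aemeasurable, (hFm.comp (hXmeas 0)).aemeasurable, by
      change P.map (F ∘ X i) = P.map (F ∘ X 0)
      rw [← Measure.map_map hFm (hXmeas i), ← Measure.map_map hFm (hXmeas 0), hXlaw, hXlaw]⟩)
  refine ⟨∫ x, F x ∂ν, fun k => ContinuousMap.integral_apply hFi k, ?_⟩
  have hmean : ∫ ω, F (X 0 ω) ∂P = ∫ x, F x ∂ν := by
    rw [← hXlaw 0, integral_map (hXmeas 0).aemeasurable hFm.aestronglyMeasurable]
  rwa [hmean] at hslln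

theorem integrable_sq_gaussianReal (m : ℝ) (v : NNReal) :
    Integrable (fun x : ℝ => x ^ 2) (gaussianReal m v) :=
  (memLp_id_gaussianReal (μ := m) (v := v) 2).integrable_sq

theorem integrable_log_mixturePDF {π : ℤˣ → ℝ} (hπ : ∀ y, 0 < π y) (hπ1 : ∑ y, π y = 1)
    {η : MixParams} (hη : ∀ y, 0 < (η y).2) (m : ℝ) (v : NNReal) :
    Integrable (fun x => Real.log (mixturePDF π η x)) (gaussianReal m v) := by
  obtain ⟨C, hC⟩ := exists_abs_log_mixturePDF_le hπ hπ1 (isCompact_singleton (x := η))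
    (by simpa using hη)
  refine Integrable.mono' (((integrable_const 1).add (integrable_sq_gaussianReal m v)).const_mul C)
    ((continuous_mixturePDF π hη).log fun x =>
      (mixturePDF_pos hπ hη x).ne').aestronglyMeasurable
    (Eventually.of_forall fun x => hC η rfl x)

/-- At the true parameters, the expected log-likelihood is strictly larger than at any other. -/
theorem integral_log_mixturePDF_score_lt {d : ℕ}
    {p : Measure (EuclideanSpace ℝ (Fin d) × ℤˣ)} [IsProbabilityMeasure p]
    (hp : labelMarginal p 1 ≠ labelMarginal p (-1)) {θ : EuclideanSpace ℝ (Fin d)}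
    {η η' : MixParams} (hη : ∀ y, 0 < (η y).2) (hη' : ∀ y, 0 < (η' y).2)
    (hlaw : ∀ y, scoreLaw p θ y = gaussianReal (η y).1 (Real.toNNReal ((η y).2 ^ 2)))
    (hne : η' ≠ η) :
    ∫ z, Real.log (mixturePDF (labelMarginal p) η' (score θ z.1)) ∂p <
      ∫ z, Real.log (mixturePDF (labelMarginal p) η (score θ z.1)) ∂p := by
  have hπ := labelMarginal_pos_of_scoreLaw_eq hlaw
  have hπ1 : ∑ y, labelMarginal p y = 1 := sum_labelMarginal
  have key : ∀ ξ : MixParams, (∀ y, 0 < (ξ y).2) →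
      Integrable (fun x => mixturePDF (labelMarginal p) η x *
        Real.log (mixturePDF (labelMarginal p) ξ x)) ∧
      ∫ z, Real.log (mixturePDF (labelMarginal p) ξ (score θ z.1)) ∂p =
        ∫ x, mixturePDF (labelMarginal p) η x * Real.log (mixturePDF (labelMarginal p) ξ x) := by
    intro ξ hξ
    have hint := fun y => integrable_log_mixturePDF hπ hπ1 hξ (η y).1
      (Real.toNNReal ((η y).2 ^ 2))
    have hint' : ∀ y, Integrable fun x => labelMarginal p y * (componentPDF η y x *
        Real.log (mixturePDF (labelMarginal p) ξ x)) := fun y => by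
      have h := hint y
      rw [gaussianReal_of_var_ne_zero _ (by simpa using (hη y).ne'),
        integrable_withDensity_iff_integrable_smul' (measurable_gaussianPDF _ _)
          (Eventually.of_forall fun x => gaussianPDF_lt_top)] at h
      simp only [toReal_gaussianPDF] at h
      exact h.const_mul _
    have hsplit : (fun x => mixturePDF (labelMarginal p) η x *
        Real.log (mixturePDF (labelMarginal p) ξ x)) = fun x => ∑ y, labelMarginal p y *
        (componentPDF η y x * Real.log (mixturePDF (labelMarginal p) ξ x)) := by
      funext x
      rw [mixturePDF, Finset.sum_mul]
      simp only [mul_assoc]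
    rw [hsplit]
    refine ⟨integrable_finsetSum _ fun y _ => hint' y, ?_⟩
    rw [integral_finsetSum _ fun y _ => hint' y]
    simp only [integral_const_mul]
    exact (integrable_and_integral_of_scoreLaw_eq hη hlaw
      (f := fun _ x => Real.log (mixturePDF (labelMarginal p) ξ x))
      (fun y => ((continuous_mixturePDF _ hξ).measurable.log)) hint).2
  rw [(key η' hη').2, (key η hη).2]
  refine integral_mul_log_lt_of_ne (continuous_mixturePDF _ hη) (continuous_mixturePDF _ hη')
    (mixturePDF_pos hπ hη) (mixturePDF_pos hπ hη') (integrable_mixturePDF _ _)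
    (integrable_mixturePDF _ _) ?_ (key η hη).1 (key η' hη').1
    fun h => hne (mixturePDF_injOn hπ hp hη' hη h)
  rw [integral_mixturePDF hπ1 hη, integral_mixturePDF hπ1 hη']

/-- The risk depends on the joint law only through the label marginals and the conditional laws of
the score. -/
theorem risk_eq_plugInRisk {d : ℕ} {p : Measure (EuclideanSpace ℝ (Fin d) × ℤˣ)}
    [IsProbabilityMeasure p] {L : ℤˣ → ℝ → ℝ} (hL : L = expLoss ∨ L = logLoss ∨ L = hingeLoss)
    {θ : EuclideanSpace ℝ (Fin d)} {η : MixParams} (hη : ∀ y, 0 < (η y).2)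
    (hlaw : ∀ y, scoreLaw p θ y = gaussianReal (η y).1 (Real.toNNReal ((η y).2 ^ 2))) :
    risk p L θ = plugInRisk (labelMarginal p) L η :=
  (integrable_and_integral_of_scoreLaw_eq hη hlaw
    (fun y => (continuous_and_bounds_of_loss hL y).1.measurable)
    fun y => integrable_loss_gaussianReal hL y _ _).2

/-- Almost surely, the averaged log-likelihoods converge, uniformly over the classifier and
mixture parameters, to the expected log-likelihood. -/
theorem exists_ae_tendsto_logLik {d : ℕ}
    {p : Measure (EuclideanSpace ℝ (Fin d) × ℤˣ)} [IsProbabilityMeasure p]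
    {Θ : Set (EuclideanSpace ℝ (Fin d))} (hΘ : IsCompact Θ) (hΘne : Θ.Nonempty)
    {E : Set MixParams} (hE : IsCompact E) (hEpos : ∀ η ∈ E, ∀ y, 0 < (η y).2)
    (hnormal : ∀ θ ∈ Θ, ∃ η ∈ E, ∀ y,
      scoreLaw p θ y = gaussianReal (η y).1 (Real.toNNReal ((η y).2 ^ 2)))
    {Ω : Type*} [MeasurableSpace Ω] {P : Measure Ω} {X : ℕ → Ω → EuclideanSpace ℝ (Fin d)}
    (hXmeas : ∀ i, Measurable (X i)) (hXindep : iIndepFun X P)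
    (hXlaw : ∀ i, P.map (X i) = p.map Prod.fst) :
    ∃ M : C(Θ × E, ℝ),
      (∀ q, M q = ∫ z, Real.log (mixturePDF (labelMarginal p) q.2 (score q.1 z.1)) ∂p) ∧
      ∀ᵐ ω ∂P, ∃ Mn : ℕ → C(Θ × E, ℝ), Tendsto Mn atTop (𝓝 M) ∧
        ∀ n q, Mn n q = (n : ℝ)⁻¹ *
          logLik (labelMarginal p) (fun i => score (q.1 : EuclideanSpace ℝ (Fin d)) (X i ω)) n
            q.2 := by
  have : CompactSpace Θ := isCompact_iff_compactSpace.1 hΘ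
  have : CompactSpace E := isCompact_iff_compactSpace.1 hE
  obtain ⟨θ₀, hθ₀⟩ := hΘne
  obtain ⟨η₀, -, hη₀⟩ := hnormal θ₀ hθ₀
  have hπ := labelMarginal_pos_of_scoreLaw_eq hη₀
  have hπ1 : ∑ y, labelMarginal p y = 1 := sum_labelMarginal
  have hL2 : ∀ θ ∈ Θ, MemLp (score θ) 2 (p.map Prod.fst) := by
    intro θ hθ
    obtain ⟨η, hηE, hη⟩ := hnormal θ hθ
    rw [memLp_two_iff_integrable_sq (continuous_score θ).aestronglyMeasurable,
      integrable_map_measure (f := Prod.fst) (g := fun x => score θ x ^ 2)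
        ((continuous_score θ).pow 2).aestronglyMeasurable
        measurable_fst.aemeasurable]
    exact (integrable_and_integral_of_scoreLaw_eq (hEpos η hηE) hη (f := fun _ x => x ^ 2)
      (fun y => by fun_prop) fun y => integrable_sq_gaussianReal _ _).1
  obtain ⟨G, hGi, hG⟩ := exists_integrable_sq_score_le hΘ.isBounded hL2
  obtain ⟨C, hC⟩ := exists_abs_log_mixturePDF_le hπ hπ1 hE hEpos
  have hC0 : 0 ≤ C := by
    obtain ⟨η, hηE, -⟩ := hnormal θ₀ hθ₀
    simpa using (abs_nonneg _).trans (hC η hηE 0)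
  have hcont : Continuous fun q : EuclideanSpace ℝ (Fin d) × (Θ × E) =>
      Real.log (mixturePDF (labelMarginal p) q.2.2 (score q.2.1 q.1)) := by
    refine Continuous.log ?_ fun q => (mixturePDF_pos hπ (hEpos _ q.2.2.2) _).ne'
    rw [← continuousOn_univ]
    refine (continuousOn_mixturePDF (labelMarginal p)).comp
      (f := fun q : EuclideanSpace ℝ (Fin d) × (Θ × E) =>
        ((q.2.2 : MixParams), score (q.2.1 : EuclideanSpace ℝ (Fin d)) q.1))
      (Continuous.continuousOn ?_) fun q _ => hEpos _ q.2.2.2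
    exact Continuous.prodMk (by fun_prop) (continuous_uncurry_score.comp
      (by fun_prop : Continuous fun q : EuclideanSpace ℝ (Fin d) × (Θ × E) =>
        ((q.2.1 : EuclideanSpace ℝ (Fin d)), q.1)))
  obtain ⟨M, hM, hconv⟩ := exists_ae_tendsto_average_continuousMap
    (ContinuousMap.curry ⟨_, hcont⟩) (G := fun x => C * (1 + G x))
    (((integrable_const 1).add hGi).const_mul C)
    (fun x q => (hC _ q.2.2 _).trans (mul_le_mul_of_nonneg_left
      (add_le_add_right (hG _ q.1.2 x) 1) hC0)) hXmeas hXindep hXlaw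
  refine ⟨M, fun q => ?_, ?_⟩
  · rw [hM q]
    have hcq : Continuous fun x => ContinuousMap.curry ⟨_, hcont⟩ x q :=
      hcont.comp (by fun_prop : Continuous fun x => (x, q))
    rw [integral_map measurable_fst.aemeasurable hcq.aestronglyMeasurable]
    rfl
  · filter_upwards [hconv] with ω hω
    refine ⟨_, hω, fun n q => ?_⟩
    simp only [ContinuousMap.smul_apply, ContinuousMap.sum_apply, smul_eq_mul]
    rfl

/-! ### Consistency of the risk minimizers -/

theorem mainTheorem1 {d : ℕ}
    -- the joint law of `(X, Y)`, with unequal label marginals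
    (p : Measure (EuclideanSpace ℝ (Fin d) × ℤˣ)) [IsProbabilityMeasure p]
    (hp : labelMarginal p 1 ≠ labelMarginal p (-1))
    -- the loss
    (L : ℤˣ → ℝ → ℝ) (hL : L = expLoss ∨ L = logLoss ∨ L = hingeLoss)
    -- the classifier parameters and the compact set of mixture parameters
    (Θ : Set (EuclideanSpace ℝ (Fin d))) (hΘ : IsCompact Θ) (hΘne : Θ.Nonempty)
    (E : Set MixParams) (hE : IsCompact E) (hEpos : ∀ η ∈ E, ∀ y, 0 < (η y).2)
    -- given `Y = y`, the score is normal, with parameters in `E`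
    (hnormal : ∀ θ ∈ Θ, ∃ η ∈ E, ∀ y,
      scoreLaw p θ y = gaussianReal (η y).1 (Real.toNNReal ((η y).2 ^ 2)))
    -- the iid unlabeled sample
    {Ω : Type*} [MeasurableSpace Ω] (P : Measure Ω) [IsProbabilityMeasure P]
    (X : ℕ → Ω → EuclideanSpace ℝ (Fin d)) (hXmeas : ∀ i, Measurable (X i))
    (hXindep : iIndepFun X P) (hXlaw : ∀ i, P.map (X i) = p.map Prod.fst)
    -- the maximum likelihood estimates of the mixture parameters, for each `θ`
    (ηhat : ℕ → Ω → EuclideanSpace ℝ (Fin d) → MixParams)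
    (hηhat : ∀ n ω, ∀ θ ∈ Θ,
      IsMLE E (labelMarginal p) (fun i => score θ (X i ω)) n (ηhat n ω θ)) :
    (argminOn (risk p L) Θ).Nonempty ∧
    (∀ᵐ ω ∂P, ∀ ε : ℝ, 0 < ε → ∃ δ : ℝ, 0 < δ ∧ ∀ᶠ n in atTop, ∀ t ∈ Θ,
      (∀ s ∈ Θ, plugInRisk (labelMarginal p) L (ηhat n ω t)
        ≤ plugInRisk (labelMarginal p) L (ηhat n ω s) + δ) →
      ∃ tstar ∈ argminOn (risk p L) Θ, dist t tstar < ε) ∧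
    (∀ tstar, argminOn (risk p L) Θ = {tstar} →
      ∀ᵐ ω ∂P, ∀ t : ℕ → EuclideanSpace ℝ (Fin d),
        (∀ᶠ n in atTop,
          t n ∈ argminOn (fun θ => plugInRisk (labelMarginal p) L (ηhat n ω θ)) Θ) →
        Tendsto t atTop (𝓝 tstar)) := by
  have : CompactSpace Θ := isCompact_iff_compactSpace.1 hΘ
  have : CompactSpace E := isCompact_iff_compactSpace.1 hE
  have : Nonempty Θ := hΘne.to_subtype
  choose! h₀ hh₀E hh₀ using hnormal
  let h : Θ → E := fun θ => ⟨h₀ θ, hh₀E θ θ.2⟩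
  let ψ : E → ℝ := fun η => plugInRisk (labelMarginal p) L η
  have hψ : Continuous ψ := continuous_plugInRisk hL _ hE hEpos
  have hrisk : ∀ θ : Θ, risk p L θ = ψ (h θ) := fun θ =>
    risk_eq_plugInRisk hL (hEpos _ (h θ).2) (hh₀ θ θ.2)
  obtain ⟨M, hM, hconv⟩ := exists_ae_tendsto_logLik hΘ hΘne hE hEpos
    (fun θ hθ => ⟨h₀ θ, hh₀E θ hθ, hh₀ θ hθ⟩) hXmeas hXindep hXlaw
  have hmax : ∀ (a : Θ) (b : E), b ≠ h a → M (a, b) < M (a, h a) := by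
    intro a b hb
    rw [hM, hM]
    exact integral_log_mixturePDF_score_lt hp (hEpos _ (h a).2) (hEpos _ b.2) (hh₀ a a.2)
      fun hab => hb (Subtype.ext hab)
  have hmem : ∀ t' : Θ, (∀ s, ψ (h t') ≤ ψ (h s)) → (t' : EuclideanSpace ℝ (Fin d)) ∈
      argminOn (risk p L) Θ := by
    refine fun t' ht' => ⟨t'.2, fun s hs => ?_⟩
    have := ht' ⟨s, hs⟩
    rw [← hrisk, ← hrisk] at this
    exact this
  have hcons : ∀ᵐ ω ∂P, ∀ ε : ℝ, 0 < ε → ∃ δ : ℝ, 0 < δ ∧ ∀ᶠ n in atTop, ∀ t ∈ Θ,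
      (∀ s ∈ Θ, plugInRisk (labelMarginal p) L (ηhat n ω t)
        ≤ plugInRisk (labelMarginal p) L (ηhat n ω s) + δ) →
      ∃ tstar ∈ argminOn (risk p L) Θ, dist t tstar < ε := by
    filter_upwards [hconv] with ω ⟨Mn, hMn, hMnlik⟩ ε hε
    obtain ⟨δ, hδ, hev⟩ := exists_eventually_dist_minimizer_lt hmax hMn
      (b := fun n θ => ⟨ηhat n ω θ, (hηhat n ω θ θ.2).1⟩) (fun n a b' => by
        rw [hMnlik, hMnlik]
        exact mul_le_mul_of_nonneg_left ((hηhat n ω a a.2).2 b'.2) (by positivity)) hψ hε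
    refine ⟨δ, hδ, hev.mono fun n hn t ht hts => ?_⟩
    obtain ⟨t', ht', hdist⟩ := hn ⟨t, ht⟩ fun s => hts s s.2
    exact ⟨t', hmem t' ht', hdist⟩
  refine ⟨?_, hcons, fun tstar htstar => ?_⟩
  · obtain ⟨t₀, -, ht₀⟩ := isCompact_univ.exists_isMinOn Set.univ_nonempty
      (hψ.comp (continuous_of_unique_max M.continuous hmax)).continuousOn
    exact ⟨t₀, hmem t₀ fun s => ht₀ (Set.mem_univ s)⟩
  · filter_upwards [hcons] with ω hω t ht
    refine Metric.tendsto_nhds.2 fun ε hε => ?_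
    obtain ⟨δ, hδ, hev⟩ := hω ε hε
    filter_upwards [hev, ht] with n hn htn
    obtain ⟨t', ht', hdist⟩ := hn (t n) htn.1 fun s hs =>
      (isMinOn_iff.1 htn.2 s hs).trans (le_add_of_nonneg_right hδ.le)
    rw [htstar, Set.mem_singleton_iff] at ht'
    exact ht' ▸ hdist
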